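/- Let $p,q\in[0,1]$ and $\beta\ge 0$, and put $a=2p-1$ and $\mu_n=\prod_{k=1}^{n-1}\left(1+\frac{\beta}{k}\right)$ for $n\ge 1$. Let $(S_n)_{n\ge 0}$ be the amnesic elephant random walk: $S_0=0$ and $S_n=X_1+\cdots+X_n$, where $\mathbb P(X_1=1)=q$, $\mathbb P(X_1=-1)=1-q$ and, for every $n\ge 1$, $$X_{n+1}=\alpha_{n+1}X_{\beta_{n+1}}\quad\text{a.s.}$$ Here $\mathbb P(\alpha_{n+1}=1)=p$, $\mathbb P(\alpha_{n+1}=-1)=1-p$, $$\mathbb P(\beta_{n+1}=k)=\frac{\beta+1}{n}\,\frac{\mu_k}{\mu_{n+1}}\qquad(1\le k\le n),$$ $\alpha_{n+1}$ and $\beta_{n+1}$ are independent of each other, and the pair $(\alpha_{n+1},\beta_{n+1})$ is independent of the past $(X_1,\dots,X_n)$. Assume that the walk is in the diffusive regime $p<\frac{4\beta+3}{4(\beta+1)}$. Then $$\lim_{n\to\infty}\frac{1}{\log n}\sum_{k=1}^n\frac{S_k^2}{k^2}=\sigma_\beta^2\quad\text{a.s.},\qquad\text{where}\quad \sigma_\beta^2=\frac{2\beta+1-a}{(1-a)\bigl(1+2\beta-2a(\beta+1)\bigr)}.$$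 -/

import Mathlib

open MeasureTheory ProbabilityTheory Filter Topology

namespace AmnesicElephant

/-- The weight `μ_n = ∏_{k=1}^{n-1} (1 + β / k)`, with `μ_1 = 1`. -/
noncomputable def memoryWeight (β : ℝ) (n : ℕ) : ℝ :=
  ∏ k ∈ Finset.Ico 1 n, (1 + β / (k : ℝ))

/-- The probability that at time `n + 1` the elephant remembers the instant `k`, `1 ≤ k ≤ n`:
`((β + 1) / n) * (μ_k / μ_{n+1})`. -/
noncomputable def memoryProb (β : ℝ) (n k : ℕ) : ℝ :=
  (β + 1) / (n : ℝ) * (memoryWeight β k / memoryWeight β (n + 1))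

/-- `IsAERW P p q β X α m` : under `P`, the sequence `X 1, X 2, …` is the sequence of steps of an
amnesic elephant random walk with memory parameter `p`, first-step parameter `q` and amnesia
parameter `β`, where `α (n + 1)` is the random sign and `m (n + 1)` the remembered instant used
at time `n + 1` (for `n ≥ 1`). The values `X 0`, `α 0`, `α 1`, `m 0`, `m 1` play no role. -/
structure IsAERW {Ω : Type*} [MeasurableSpace Ω] (P : Measure Ω) (p q β : ℝ)
    (X : ℕ → Ω → ℝ) (α : ℕ → Ω → ℝ) (m : ℕ → Ω → ℕ) : Prop where
  measurable_step : ∀ n, 1 ≤ n → Measurable (X n)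
  measurable_sign : ∀ n, 1 ≤ n → Measurable (α (n + 1))
  measurable_memory : ∀ n, 1 ≤ n → Measurable (m (n + 1))
  /-- The first step is `1` with probability `q` and `-1` with probability `1 - q`. -/
  first_right : P {ω | X 1 ω = 1} = ENNReal.ofReal q
  first_left : P {ω | X 1 ω = -1} = ENNReal.ofReal (1 - q)
  /-- The sign is `1` with probability `p` and `-1` with probability `1 - p`. -/
  sign_pos : ∀ n, 1 ≤ n → P {ω | α (n + 1) ω = 1} = ENNReal.ofReal p
  sign_neg : ∀ n, 1 ≤ n → P {ω | α (n + 1) ω = -1} = ENNReal.ofReal (1 - p)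
  /-- The law of the remembered instant, on `{1, …, n}`. -/
  memory_law : ∀ n k, 1 ≤ k → k ≤ n →
    P {ω | m (n + 1) ω = k} = ENNReal.ofReal (memoryProb β n k)
  /-- The sign and the remembered instant are independent of each other, … -/
  indep_sign_memory : ∀ n, 1 ≤ n → IndepFun (α (n + 1)) (m (n + 1)) P
  /-- … and the pair is independent of the past `(X 1, …, X n)`. -/
  indep_past : ∀ n, 1 ≤ n →
    IndepFun (fun ω => (α (n + 1) ω, m (n + 1) ω))
      (fun ω => fun k : Finset.Icc 1 n => X k ω) P
  /-- The step at time `n + 1` repeats or reverses the remembered step. -/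
  step_succ : ∀ n, 1 ≤ n → ∀ᵐ ω ∂P, X (n + 1) ω = α (n + 1) ω * X (m (n + 1) ω) ω

/-- The position `S_n = X_1 + ⋯ + X_n`, with `S_0 = 0`. -/
def position {Ω : Type*} (X : ℕ → Ω → ℝ) (n : ℕ) (ω : Ω) : ℝ :=
  ∑ k ∈ Finset.Icc 1 n, X k ω

/-- `σ_β² = (2β + 1 - a) / ((1 - a) (1 + 2β - 2a(β + 1)))` with `a = 2p - 1`. -/
noncomputable def sigmaSq (p β : ℝ) : ℝ :=
  let a := 2 * p - 1
  (2 * β + 1 - a) / ((1 - a) * (1 + 2 * β - 2 * a * (β + 1)))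

end AmnesicElephant

/-! Put `a = 2p - 1`, `c = a(β + 1)` and let `Z n` be the weighted position. Averaging over sign and
remembered instant gives `E[X (n+1) | past] = c Z n / (n + β)`, so `(Z, S)` obeys a closed linear
recursion driven by bounded martingale differences. The constants `x`, `y` are chosen so that `Q n =
(x Z² + 2y Z S + S²) / n` has conditional drift `-S² / n² + (x + 2y + 1) / (n + 1)` up to a
remainder of order `(Z² + S²) / n³`. Summing (`sum_position_sq_div_eq`), `∑ S_k² / k²` equals `σ² ∑
1 / (k + 1)`, with `σ² = x + 2y + 1`, plus a boundary term in `Q`, a martingale and a summed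
remainder.

In the diffusive regime, `2c < 2β + 1`, the second moments of `Z n` and `S n` are `O(n)`. Hence the
boundary and remainder terms are bounded in `L¹`, and the martingale has variance `O(log n)`. Along
`n = 2 ^ (j ^ 2)`, dividing by `(j + 1)²` makes the first moments (the second moment, for the
martingale) summable in `j`, so all errors vanish almost surely. Since the sum is monotone and `(j +
1)² / j² → 1`, this subsequence suffices (`tendsto_div_log_of_monotone`). -/

namespace AmnesicElephant

/-! ### Memory weights -/

section Weights

variable {β : ℝ}

lemma memoryWeight_pos (hβ : 0 ≤ β) (n : ℕ) : 0 < memoryWeight β n :=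
  Finset.prod_pos fun k _ => by positivity

lemma memoryWeight_succ (β : ℝ) {n : ℕ} (hn : 1 ≤ n) :
    memoryWeight β (n + 1) = memoryWeight β n * (1 + β / n) :=
  Finset.prod_Ico_succ_top hn _

/-- Telescoping: `k μ_{k+1} = (k + β) μ_k`, so `k μ_{k+1} - (k - 1) μ_k = (β + 1) μ_k`. This is what
makes the memory law a probability. -/
lemma sum_memoryWeight (β : ℝ) (n : ℕ) :
    (β + 1) * ∑ k ∈ Finset.Icc 1 n, memoryWeight β k = n * memoryWeight β (n + 1) := by
  induction n with
  | zero => simp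
  | succ n ih =>
    rw [Finset.sum_Icc_succ_top (by omega), mul_add, ih, memoryWeight_succ β (n := n + 1) (by omega)]
    have : ((n + 1 : ℕ) : ℝ) ≠ 0 := by positivity
    field_simp
    push_cast
    ring

lemma memoryProb_nonneg (hβ : 0 ≤ β) (n k : ℕ) : 0 ≤ memoryProb β n k := by
  have h1 := memoryWeight_pos hβ k
  have h2 := memoryWeight_pos hβ (n + 1)
  unfold memoryProb
  positivity

lemma sum_memoryProb (hβ : 0 ≤ β) {n : ℕ} (hn : 1 ≤ n) :
    ∑ k ∈ Finset.Icc 1 n, memoryProb β n k = 1 := by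
  have h := sum_memoryWeight β n
  have h2 := memoryWeight_pos hβ (n + 1)
  have hn' : (0 : ℝ) < n := by exact_mod_cast hn
  simp only [memoryProb]
  rw [← Finset.mul_sum, ← Finset.sum_div]
  field_simp
  linarith

end Weights

/-! ### The weighted position -/

section WeightedPosition

variable {Ω : Type*}

/-- The weighted position `∑_{k ≤ n} (μ_k / μ_n) X_k`, which drives the conditional law of the
next step. -/
noncomputable def weightedPosition (β : ℝ) (X : ℕ → Ω → ℝ) (n : ℕ) (ω : Ω) : ℝ :=
  ∑ k ∈ Finset.Icc 1 n, memoryWeight β k / memoryWeight β n * X k ω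

lemma position_succ (X : ℕ → Ω → ℝ) (n : ℕ) (ω : Ω) :
    position X (n + 1) ω = position X n ω + X (n + 1) ω :=
  Finset.sum_Icc_succ_top (by omega) _

lemma position_one (X : ℕ → Ω → ℝ) (ω : Ω) : position X 1 ω = X 1 ω := by
  simp [position]

lemma weightedPosition_one (β : ℝ) (X : ℕ → Ω → ℝ) (ω : Ω) :
    weightedPosition β X 1 ω = X 1 ω := by
  simp [weightedPosition, memoryWeight]

/-- Changing the normalisation from `μ_n` to `μ_{n+1}` rescales every old term by `μ_n / μ_{n+1} = n
/ (n + β)`. -/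
lemma weightedPosition_succ {β : ℝ} (hβ : 0 ≤ β) (X : ℕ → Ω → ℝ) {n : ℕ} (hn : 1 ≤ n) (ω : Ω) :
    weightedPosition β X (n + 1) ω = n / (n + β) * weightedPosition β X n ω + X (n + 1) ω := by
  have h1 := memoryWeight_pos hβ n
  have h2 := memoryWeight_pos hβ (n + 1)
  have hn' : (0 : ℝ) < n := by exact_mod_cast hn
  rw [weightedPosition, Finset.sum_Icc_succ_top (by omega), div_self h2.ne', one_mul,
    weightedPosition, Finset.mul_sum, memoryWeight_succ β hn]
  congr 1
  refine Finset.sum_congr rfl fun k _ => ?_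
  field_simp

lemma sum_memoryProb_mul {β : ℝ} (hβ : 0 ≤ β) (X : ℕ → Ω → ℝ) {n : ℕ} (hn : 1 ≤ n) (ω : Ω) :
    ∑ k ∈ Finset.Icc 1 n, memoryProb β n k * X k ω =
      (β + 1) / (n + β) * weightedPosition β X n ω := by
  have h1 := memoryWeight_pos hβ n
  have hn' : (0 : ℝ) < n := by exact_mod_cast hn
  rw [weightedPosition, Finset.mul_sum]
  refine Finset.sum_congr rfl fun k _ => ?_
  rw [memoryProb, memoryWeight_succ β hn]
  field_simp

end WeightedPosition

/-! ### Filtration and conditional mean of the next step -/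

section Past

variable {Ω : Type*}

/-- The σ-algebra generated by the steps `X 1, …, X n`. -/
abbrev past (X : ℕ → Ω → ℝ) (n : ℕ) : MeasurableSpace Ω :=
  MeasurableSpace.comap (fun ω => fun k : Finset.Icc 1 n => X k ω) inferInstance

lemma measurable_past_step (X : ℕ → Ω → ℝ) {n k : ℕ} (h1 : 1 ≤ k) (hk : k ≤ n) :
    Measurable[past X n] (X k) := by
  have h : Measurable[past X n] (fun ω => fun k : Finset.Icc 1 n => X k ω) := comap_measurable _
  exact (measurable_pi_apply (⟨k, Finset.mem_Icc.2 ⟨h1, hk⟩⟩ : Finset.Icc 1 n)).comp h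

lemma measurable_past_position (X : ℕ → Ω → ℝ) {n k : ℕ} (hk : k ≤ n) :
    Measurable[past X n] (position X k) := by
  let _ := past X n
  refine Finset.measurable_fun_sum _ fun i hi => ?_
  rw [Finset.mem_Icc] at hi
  exact measurable_past_step X hi.1 (hi.2.trans hk)

lemma measurable_past_weightedPosition (β : ℝ) (X : ℕ → Ω → ℝ) {n k : ℕ} (hk : k ≤ n) :
    Measurable[past X n] (weightedPosition β X k) := by
  let _ := past X n
  refine Finset.measurable_fun_sum _ fun i hi => ?_
  rw [Finset.mem_Icc] at hi
  exact (measurable_past_step X hi.1 (hi.2.trans hk)).const_mul _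

end Past

lemma ae_eq_one_or_eq_neg_one {Ω : Type*} [MeasurableSpace Ω] {P : Measure Ω}
    [IsProbabilityMeasure P] {f : Ω → ℝ} (hf : Measurable f) {p : ℝ} (hp0 : 0 ≤ p) (hp1 : p ≤ 1)
    (h1 : P {ω | f ω = 1} = ENNReal.ofReal p) (h2 : P {ω | f ω = -1} = ENNReal.ofReal (1 - p)) :
    ∀ᵐ ω ∂P, f ω = 1 ∨ f ω = -1 := by
  have hm1 : MeasurableSet {ω | f ω = 1} := hf (measurableSet_singleton 1)
  have hm2 : MeasurableSet {ω | f ω = -1} := hf (measurableSet_singleton (-1))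
  have hd : Disjoint {ω | f ω = 1} {ω | f ω = -1} := by
    rw [Set.disjoint_left]
    intro ω ha hb
    simp only [Set.mem_ofPred_eq] at ha hb
    linarith
  have : P ({ω | f ω = 1} ∪ {ω | f ω = -1}) = 1 := by
    rw [measure_union hd hm2, h1, h2, ← ENNReal.ofReal_add hp0 (by linarith)]
    simp
  exact (prob_compl_eq_zero_iff (hm1.union hm2)).2 this

lemma integral_of_eq_one_or_eq_neg_one {Ω : Type*} [MeasurableSpace Ω] {P : Measure Ω}
    [IsProbabilityMeasure P] {f : Ω → ℝ} (hf : Measurable f) {p : ℝ} (hp0 : 0 ≤ p) (hp1 : p ≤ 1)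
    (h1 : P {ω | f ω = 1} = ENNReal.ofReal p) (h2 : P {ω | f ω = -1} = ENNReal.ofReal (1 - p)) :
    ∫ ω, f ω ∂P = 2 * p - 1 := by
  have hm1 : MeasurableSet {ω | f ω = 1} := hf (measurableSet_singleton 1)
  have : f =ᵐ[P] fun ω => 2 * ({ω | f ω = 1}.indicator 1 ω) - 1 := by
    filter_upwards [ae_eq_one_or_eq_neg_one hf hp0 hp1 h1 h2] with ω h
    rcases h with h | h
    · simp [h]; norm_num
    · have : ¬ ((-1 : ℝ) = 1) := by norm_num
      simp [h, this]
  rw [integral_congr_ae this, integral_sub, integral_const_mul, integral_indicator_one hm1]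
  · simp [measureReal_def, h1, hp0]
  · exact ((integrable_const 1).indicator hm1).const_mul 2
  · exact integrable_const _

namespace IsAERW

variable {Ω : Type*} [MeasurableSpace Ω] {P : Measure Ω}
  {p q β : ℝ} {X : ℕ → Ω → ℝ} {α : ℕ → Ω → ℝ} {m : ℕ → Ω → ℕ}

lemma past_le (hX : IsAERW P p q β X α m) (n : ℕ) : past X n ≤ ‹MeasurableSpace Ω› := by
  refine Measurable.comap_le (measurable_pi_lambda _ fun k => ?_)
  exact hX.measurable_step k (Finset.mem_Icc.1 k.2).1

variable [IsProbabilityMeasure P]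

/-- The prescribed atoms `1, …, n` already carry total mass one, so no mass is left elsewhere. -/
lemma memory_ae (hX : IsAERW P p q β X α m) (hβ : 0 ≤ β) {n : ℕ} (hn : 1 ≤ n) :
    ∀ᵐ ω ∂P, m (n + 1) ω ∈ Finset.Icc 1 n := by
  have hms : ∀ k, MeasurableSet {ω | m (n + 1) ω = k} := fun k =>
    hX.measurable_memory n hn (measurableSet_singleton k)
  have hU : MeasurableSet (⋃ k ∈ Finset.Icc 1 n, {ω | m (n + 1) ω = k}) :=
    Finset.measurableSet_biUnion _ fun k _ => hms k
  have h1 : P (⋃ k ∈ Finset.Icc 1 n, {ω | m (n + 1) ω = k}) = 1 := by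
    rw [measure_biUnion_finset _ fun k _ => hms k]
    · rw [Finset.sum_congr rfl fun k hk => hX.memory_law n k (Finset.mem_Icc.1 hk).1
        (Finset.mem_Icc.1 hk).2, ← ENNReal.ofReal_sum_of_nonneg
        fun k _ => memoryProb_nonneg hβ n k, sum_memoryProb hβ hn]
      simp
    · intro i _ j _ hij
      rw [Function.onFun, Set.disjoint_left]
      intro ω ha hb
      exact hij (ha.symm.trans hb)
  filter_upwards [(prob_compl_eq_zero_iff hU).2 h1] with ω h
  simpa using h

end IsAERW

lemma integral_mul_of_indep {Ω : Type*} {F mΩ : MeasurableSpace Ω} {P : Measure[mΩ] Ω}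
    (hF : F ≤ mΩ) {E : Type*} [MeasurableSpace E] {U : Ω → E}
    (h : Indep (MeasurableSpace.comap U inferInstance) F P)
    {φ : E → ℝ} (hφ : Measurable φ) (hU : Measurable U) {g : Ω → ℝ} (hg : Measurable[F] g) :
    ∫ ω, φ (U ω) * g ω ∂P = (∫ ω, φ (U ω) ∂P) * ∫ ω, g ω ∂P := by
  have hi : IndepFun (fun ω => φ (U ω)) g P := by
    rw [IndepFun_iff_Indep]
    refine indep_of_indep_of_le_left (indep_of_indep_of_le_right h hg.comap_le) ?_
    change MeasurableSpace.comap (φ ∘ U) _ ≤ _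
    rw [← MeasurableSpace.comap_comp]
    exact MeasurableSpace.comap_mono hφ.comap_le
  exact hi.integral_fun_mul_eq_mul_integral (hφ.comp hU).aestronglyMeasurable
    (hg.mono hF le_rfl).aestronglyMeasurable

namespace IsAERW

variable {Ω : Type*} [MeasurableSpace Ω] {P : Measure Ω} [IsProbabilityMeasure P]
  {p q β : ℝ} {X : ℕ → Ω → ℝ} {α : ℕ → Ω → ℝ} {m : ℕ → Ω → ℕ}

/-- One null set serves all `n`. The induction is strong because the remembered instant may be any
earlier time. -/
lemma step_sq_ae (hX : IsAERW P p q β X α m) (hp0 : 0 ≤ p) (hp1 : p ≤ 1) (hq0 : 0 ≤ q)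
    (hq1 : q ≤ 1) (hβ : 0 ≤ β) : ∀ᵐ ω ∂P, ∀ n, 1 ≤ n → X n ω ^ 2 = 1 := by
  have h1 := ae_eq_one_or_eq_neg_one (hX.measurable_step 1 le_rfl) hq0 hq1 hX.first_right
    hX.first_left
  have h2 : ∀ᵐ ω ∂P, ∀ n, 1 ≤ n → (α (n + 1) ω = 1 ∨ α (n + 1) ω = -1) ∧
      m (n + 1) ω ∈ Finset.Icc 1 n ∧ X (n + 1) ω = α (n + 1) ω * X (m (n + 1) ω) ω := by
    rw [ae_all_iff]
    intro n
    by_cases hn : 1 ≤ n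
    · filter_upwards [ae_eq_one_or_eq_neg_one (hX.measurable_sign n hn) hp0 hp1 (hX.sign_pos n hn)
        (hX.sign_neg n hn), hX.memory_ae hβ hn, hX.step_succ n hn] with ω ha hb hc _
      exact ⟨ha, hb, hc⟩
    · exact ae_of_all _ fun ω h => absurd h hn
  filter_upwards [h1, h2] with ω h1 h2 n
  induction n using Nat.strong_induction_on with
  | _ n ih =>
    intro hn
    obtain rfl | ⟨k, hk, rfl⟩ : n = 1 ∨ ∃ k, 1 ≤ k ∧ n = k + 1 := by
      rcases Nat.lt_or_ge 1 n with h | h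
      · exact Or.inr ⟨n - 1, by omega, by omega⟩
      · exact Or.inl (by omega)
    · rcases h1 with h | h <;> simp [h]
    · obtain ⟨ha, hb, hc⟩ := h2 k hk
      rw [Finset.mem_Icc] at hb
      rw [hc, mul_pow, ih _ (by omega) hb.1]
      rcases ha with h | h <;> simp [h]

lemma memLp_step (hX : IsAERW P p q β X α m) (hp0 : 0 ≤ p) (hp1 : p ≤ 1) (hq0 : 0 ≤ q)
    (hq1 : q ≤ 1) (hβ : 0 ≤ β) {n : ℕ} (hn : 1 ≤ n) : MemLp (X n) ⊤ P := by
  refine memLp_top_of_bound (hX.measurable_step n hn).aestronglyMeasurable 1 ?_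
  filter_upwards [hX.step_sq_ae hp0 hp1 hq0 hq1 hβ] with ω h
  rw [Real.norm_eq_abs, abs_le_one_iff_mul_self_le_one, ← sq, h n hn]

lemma memLp_position (hX : IsAERW P p q β X α m) (hp0 : 0 ≤ p) (hp1 : p ≤ 1) (hq0 : 0 ≤ q)
    (hq1 : q ≤ 1) (hβ : 0 ≤ β) (n : ℕ) : MemLp (position X n) ⊤ P :=
  memLp_finsetSum _ fun _ hk => hX.memLp_step hp0 hp1 hq0 hq1 hβ (Finset.mem_Icc.1 hk).1

lemma memLp_weightedPosition (hX : IsAERW P p q β X α m) (hp0 : 0 ≤ p) (hp1 : p ≤ 1)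
    (hq0 : 0 ≤ q) (hq1 : q ≤ 1) (hβ : 0 ≤ β) (n : ℕ) : MemLp (weightedPosition β X n) ⊤ P :=
  memLp_finsetSum _ fun _ hk =>
    (hX.memLp_step hp0 hp1 hq0 hq1 hβ (Finset.mem_Icc.1 hk).1).const_mul _

lemma integral_sign_indicator (hX : IsAERW P p q β X α m) (hp0 : 0 ≤ p) (hp1 : p ≤ 1)
    (hβ : 0 ≤ β) {n k : ℕ} (h1 : 1 ≤ k) (hk : k ≤ n) :
    ∫ ω, α (n + 1) ω * (if m (n + 1) ω = k then 1 else 0) ∂P =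
      (2 * p - 1) * memoryProb β n k := by
  have hn := h1.trans hk
  have hφ : Measurable (fun j : ℕ => if j = k then (1 : ℝ) else 0) := measurable_of_countable _
  have hi := (hX.indep_sign_memory n hn).comp measurable_id hφ
  have := hi.integral_fun_mul_eq_mul_integral (hX.measurable_sign n hn).aestronglyMeasurable
    (hφ.comp (hX.measurable_memory n hn)).aestronglyMeasurable
  simp only [Function.comp_def, id] at this
  rw [this, integral_of_eq_one_or_eq_neg_one (hX.measurable_sign n hn) hp0 hp1
    (hX.sign_pos n hn) (hX.sign_neg n hn)]
  congr 1
  have hms : MeasurableSet {ω | m (n + 1) ω = k} :=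
    hX.measurable_memory n hn (measurableSet_singleton k)
  have h2 : (fun ω => if m (n + 1) ω = k then (1 : ℝ) else 0) =
      {ω | m (n + 1) ω = k}.indicator 1 := by
    ext ω
    simp [Set.indicator_apply]
  rw [h2, integral_indicator_one hms, measureReal_def, hX.memory_law n k h1 hk,
    ENNReal.toReal_ofReal (memoryProb_nonneg hβ n k)]

/-- The conditional expectation of the step `X (n + 1)` given the past is
`(2p - 1) (β + 1) / (n + β)` times the weighted position, tested against bounded functions
of the past. -/
lemma integral_mul_step (hX : IsAERW P p q β X α m) (hp0 : 0 ≤ p) (hp1 : p ≤ 1) (hq0 : 0 ≤ q)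
    (hq1 : q ≤ 1) (hβ : 0 ≤ β) {n : ℕ} (hn : 1 ≤ n) {g : Ω → ℝ} (hg : Measurable[past X n] g)
    (hgb : MemLp g ⊤ P) :
    ∫ ω, g ω * X (n + 1) ω ∂P =
      (2 * p - 1) * (β + 1) / (n + β) * ∫ ω, g ω * weightedPosition β X n ω ∂P := by
  have hmem : ∀ k ∈ Finset.Icc 1 n, MemLp (fun ω => X k ω * g ω) ⊤ P := fun k hk =>
    hgb.mul (hX.memLp_step hp0 hp1 hq0 hq1 hβ (Finset.mem_Icc.1 hk).1)
  have hφ : ∀ k : ℕ, Measurable (fun u : ℝ × ℕ => u.1 * (if u.2 = k then (1 : ℝ) else 0)) :=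
    fun k => measurable_fst.mul ((measurable_of_countable
      (fun j : ℕ => if j = k then (1 : ℝ) else 0)).comp measurable_snd)
  have hU : Measurable (fun ω => (α (n + 1) ω, m (n + 1) ω)) :=
    (hX.measurable_sign n hn).prodMk (hX.measurable_memory n hn)
  have hV : ∀ k : ℕ, MemLp (fun ω => α (n + 1) ω * (if m (n + 1) ω = k then (1 : ℝ) else 0))
      ⊤ P := by
    intro k
    refine memLp_top_of_bound ((hφ k).comp hU).aestronglyMeasurable 1 ?_
    filter_upwards [ae_eq_one_or_eq_neg_one (hX.measurable_sign n hn) hp0 hp1 (hX.sign_pos n hn)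
        (hX.sign_neg n hn)] with ω h
    rcases h with h | h <;> rw [h] <;> split_ifs <;> simp
  -- Splitting on the remembered instant replaces the random index by indicators, so each summand
  -- factors into a function of the fresh pair and a function of the past.
  have h1 : (fun ω => g ω * X (n + 1) ω) =ᵐ[P] fun ω => ∑ k ∈ Finset.Icc 1 n,
      α (n + 1) ω * (if m (n + 1) ω = k then (1 : ℝ) else 0) * (X k ω * g ω) := by
    filter_upwards [hX.memory_ae hβ hn, hX.step_succ n hn] with ω ha hb
    rw [hb, Finset.sum_eq_single_of_mem _ ha]
    · simp
      ring
    · intro k _ hk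
      simp [hk.symm]
  have hind : Indep (MeasurableSpace.comap (fun ω => (α (n + 1) ω, m (n + 1) ω)) inferInstance)
      (past X n) P := (IndepFun_iff_Indep _ _ _).1 (hX.indep_past n hn)
  have h2 : ∀ k ∈ Finset.Icc 1 n,
      ∫ ω, α (n + 1) ω * (if m (n + 1) ω = k then (1 : ℝ) else 0) * (X k ω * g ω) ∂P =
        ∫ ω, (2 * p - 1) * memoryProb β n k * (X k ω * g ω) ∂P := by
    intro k hk
    rw [Finset.mem_Icc] at hk
    have := integral_mul_of_indep (hX.past_le n) hind (hφ k) hU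
      (g := fun ω => X k ω * g ω) (Measurable.mul (measurable_past_step X hk.1 hk.2) hg)
    simp only at this
    rw [this, hX.integral_sign_indicator hp0 hp1 hβ hk.1 hk.2, integral_const_mul]
  rw [integral_congr_ae h1, integral_finsetSum, Finset.sum_congr rfl h2, ← integral_finsetSum,
    ← integral_const_mul]
  · refine integral_congr_ae (ae_of_all _ fun ω => ?_)
    have := sum_memoryProb_mul hβ X hn ω
    simp only
    calc _ = (2 * p - 1) * g ω * ∑ k ∈ Finset.Icc 1 n, memoryProb β n k * X k ω := by
          rw [Finset.mul_sum]
          exact Finset.sum_congr rfl fun k _ => by ring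
      _ = _ := by rw [this]; ring
  · exact fun k hk => ((hmem k hk).const_mul _).integrable le_top
  · exact fun k hk => ((hmem k hk).mul (hV k)).integrable le_top

end IsAERW

/-! ### Innovations as martingale differences -/

lemma integral_linear_comb {Ω : Type*} [MeasurableSpace Ω] {P : Measure Ω} {f g h : Ω → ℝ}
    (hf : Integrable f P) (hg : Integrable g P) (hh : Integrable h P) (a b c : ℝ) :
    ∫ ω, (a * f ω + b * g ω + c * h ω) ∂P =
      a * ∫ ω, f ω ∂P + b * ∫ ω, g ω ∂P + c * ∫ ω, h ω ∂P := by
  have hfg : Integrable (fun ω => a * f ω + b * g ω) P := (hf.const_mul a).add (hg.const_mul b)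
  rw [integral_add hfg (hh.const_mul c), integral_add (hf.const_mul a) (hg.const_mul b),
    integral_const_mul, integral_const_mul, integral_const_mul]

/-- The innovation `X_{n+1} - E[X_{n+1} | X_1, …, X_n]`. -/
noncomputable def innovation {Ω : Type*} (p β : ℝ) (X : ℕ → Ω → ℝ) (n : ℕ) (ω : Ω) : ℝ :=
  X (n + 1) ω - (2 * p - 1) * (β + 1) / (n + β) * weightedPosition β X n ω

lemma measurable_past_innovation {Ω : Type*} (p β : ℝ) (X : ℕ → Ω → ℝ) {n k : ℕ} (hk : k < n) :
    Measurable[past X n] (innovation p β X k) := by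
  let _ := past X n
  exact (measurable_past_step X (Nat.succ_pos k) hk).sub
    ((measurable_past_weightedPosition β X hk.le).const_mul _)

namespace IsAERW

variable {Ω : Type*} [MeasurableSpace Ω] {P : Measure Ω} [IsProbabilityMeasure P]
  {p q β : ℝ} {X : ℕ → Ω → ℝ} {α : ℕ → Ω → ℝ} {m : ℕ → Ω → ℕ}

lemma memLp_innovation (hX : IsAERW P p q β X α m) (hp0 : 0 ≤ p) (hp1 : p ≤ 1) (hq0 : 0 ≤ q)
    (hq1 : q ≤ 1) (hβ : 0 ≤ β) (n : ℕ) : MemLp (innovation p β X n) ⊤ P :=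
  (hX.memLp_step hp0 hp1 hq0 hq1 hβ (Nat.succ_pos n)).sub
    ((hX.memLp_weightedPosition hp0 hp1 hq0 hq1 hβ n).const_mul _)

/-- The martingale difference property in tested form, which avoids conditional expectations. -/
lemma integral_mul_innovation (hX : IsAERW P p q β X α m) (hp0 : 0 ≤ p) (hp1 : p ≤ 1)
    (hq0 : 0 ≤ q) (hq1 : q ≤ 1) (hβ : 0 ≤ β) {n : ℕ} (hn : 1 ≤ n) {g : Ω → ℝ}
    (hg : Measurable[past X n] g) (hgb : MemLp g ⊤ P) :
    ∫ ω, g ω * innovation p β X n ω ∂P = 0 := by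
  have h1 : Integrable (fun ω => g ω * X (n + 1) ω) P :=
    ((hX.memLp_step hp0 hp1 hq0 hq1 hβ (Nat.succ_pos n)).mul hgb).integrable le_top
  have h2 : Integrable (fun ω => g ω * weightedPosition β X n ω) P :=
    ((hX.memLp_weightedPosition hp0 hp1 hq0 hq1 hβ n).mul hgb).integrable le_top
  have h3 : (fun ω => g ω * innovation p β X n ω) = fun ω => g ω * X (n + 1) ω -
      (2 * p - 1) * (β + 1) / (n + β) * (g ω * weightedPosition β X n ω) := by
    ext ω
    rw [innovation]
    ring
  rw [h3, integral_sub h1 (h2.const_mul _), integral_const_mul,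
    hX.integral_mul_step hp0 hp1 hq0 hq1 hβ hn hg hgb, sub_self]

/-- From `X² = 1`, the innovation `ε` satisfies `ε² = 1 - κ² Z² - 2κ Z ε`. The last term integrates
to zero against `g²`, and the middle one is nonpositive. -/
lemma integral_mul_innovation_sq_le (hX : IsAERW P p q β X α m) (hp0 : 0 ≤ p) (hp1 : p ≤ 1)
    (hq0 : 0 ≤ q) (hq1 : q ≤ 1) (hβ : 0 ≤ β) {n : ℕ} (hn : 1 ≤ n) {g : Ω → ℝ}
    (hg : Measurable[past X n] g) (hgb : MemLp g ⊤ P) :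
    ∫ ω, (g ω * innovation p β X n ω) ^ 2 ∂P ≤ ∫ ω, g ω ^ 2 ∂P := by
  set κ : ℝ := (2 * p - 1) * (β + 1) / (n + β) with hκ
  set Z := weightedPosition β X n with hZ
  have hZb : MemLp Z ⊤ P := hX.memLp_weightedPosition hp0 hp1 hq0 hq1 hβ n
  have hZm : Measurable[past X n] Z := measurable_past_weightedPosition β X le_rfl
  have hgg : MemLp (fun ω => g ω * g ω) ⊤ P := hgb.mul hgb
  have hgZ : MemLp (fun ω => g ω * Z ω) ⊤ P := hZb.mul hgb
  have hggZ : MemLp (fun ω => g ω * g ω * Z ω) ⊤ P := hZb.mul hgg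
  have hggZm : Measurable[past X n] (fun ω => g ω * g ω * Z ω) := by
    let _ := past X n
    exact (hg.mul hg).mul hZm
  have h0 := hX.integral_mul_innovation hp0 hp1 hq0 hq1 hβ hn hggZm hggZ
  have h1 : (fun ω => (g ω * innovation p β X n ω) ^ 2) =ᵐ[P] fun ω => 1 * (g ω * g ω) +
      (-κ ^ 2) * ((g ω * Z ω) * (g ω * Z ω)) +
      (-2 * κ) * (g ω * g ω * Z ω * innovation p β X n ω) := by
    filter_upwards [hX.step_sq_ae hp0 hp1 hq0 hq1 hβ] with ω h
    have h := h (n + 1) (Nat.succ_pos n)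
    have h' : X (n + 1) ω = innovation p β X n ω + κ * Z ω := by rw [innovation]; ring
    rw [h'] at h
    linear_combination (g ω) ^ 2 * h
  have i1 : Integrable (fun ω => g ω * g ω) P := hgg.integrable le_top
  have i2 : Integrable (fun ω => (g ω * Z ω) * (g ω * Z ω)) P := (hgZ.mul hgZ).integrable le_top
  have i3 : Integrable (fun ω => g ω * g ω * Z ω * innovation p β X n ω) P :=
    ((hX.memLp_innovation hp0 hp1 hq0 hq1 hβ n).mul hggZ).integrable le_top
  rw [integral_congr_ae h1, integral_linear_comb i1 i2 i3, h0]
  have : 0 ≤ ∫ ω, (g ω * Z ω) * (g ω * Z ω) ∂P := integral_nonneg fun ω => mul_self_nonneg _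
  simp only [pow_two (g _)]
  nlinarith [sq_nonneg κ, mul_nonneg (sq_nonneg κ) this]

/-- The innovations are orthogonal: second moment of a martingale transform. -/
lemma integral_sum_mul_innovation_sq_le (hX : IsAERW P p q β X α m) (hp0 : 0 ≤ p) (hp1 : p ≤ 1)
    (hq0 : 0 ≤ q) (hq1 : q ≤ 1) (hβ : 0 ≤ β) {g : ℕ → Ω → ℝ}
    (hg : ∀ k n, k ≤ n → Measurable[past X n] (g k)) (hgb : ∀ k, MemLp (g k) ⊤ P) (n : ℕ) :
    ∫ ω, (∑ k ∈ Finset.Icc 1 n, g k ω * innovation p β X k ω) ^ 2 ∂P ≤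
      ∑ k ∈ Finset.Icc 1 n, ∫ ω, g k ω ^ 2 ∂P := by
  have hb : ∀ k, MemLp (fun ω => g k ω * innovation p β X k ω) ⊤ P := fun k =>
    (hX.memLp_innovation hp0 hp1 hq0 hq1 hβ k).mul (hgb k)
  induction n with
  | zero => simp
  | succ n ih =>
    set M : Ω → ℝ := fun ω => ∑ k ∈ Finset.Icc 1 n, g k ω * innovation p β X k ω with hM
    have hMb : MemLp M ⊤ P := memLp_finsetSum _ fun k _ => hb k
    have hMm : Measurable[past X (n + 1)] M := by
      let _ := past X (n + 1)
      refine Finset.measurable_fun_sum _ fun k hk => ?_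
      have := (Finset.mem_Icc.1 hk).2
      exact (hg k (n + 1) (by omega)).mul (measurable_past_innovation p β X (by omega))
    have hMgm : Measurable[past X (n + 1)] (fun ω => M ω * g (n + 1) ω) := by
      let _ := past X (n + 1)
      exact hMm.mul (hg _ _ le_rfl)
    have hMgb : MemLp (fun ω => M ω * g (n + 1) ω) ⊤ P := (hgb _).mul hMb
    have h0 := hX.integral_mul_innovation hp0 hp1 hq0 hq1 hβ (Nat.succ_pos n) hMgm hMgb
    have h1 := hX.integral_mul_innovation_sq_le hp0 hp1 hq0 hq1 hβ (Nat.succ_pos n)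
      (hg (n + 1) _ le_rfl) (hgb (n + 1))
    have i1 : Integrable (fun ω => M ω ^ 2) P := by
      simp only [pow_two]
      exact (hMb.mul hMb).integrable le_top
    have i2 : Integrable (fun ω => (g (n + 1) ω * innovation p β X (n + 1) ω) ^ 2) P := by
      simp only [pow_two]
      exact ((hb _).mul (hb _)).integrable le_top
    have i3 : Integrable (fun ω => M ω * g (n + 1) ω * innovation p β X (n + 1) ω) P :=
      ((hX.memLp_innovation hp0 hp1 hq0 hq1 hβ (n + 1)).mul hMgb).integrable le_top
    have h2 : (fun ω => (∑ k ∈ Finset.Icc 1 (n + 1), g k ω * innovation p β X k ω) ^ 2) =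
        fun ω => 1 * M ω ^ 2 + 2 * (M ω * g (n + 1) ω * innovation p β X (n + 1) ω) +
          1 * (g (n + 1) ω * innovation p β X (n + 1) ω) ^ 2 := by
      ext ω
      rw [Finset.sum_Icc_succ_top (by omega)]
      ring
    rw [h2, integral_linear_comb i1 i3 i2, h0, Finset.sum_Icc_succ_top (by omega)]
    linarith

/-! ### Linear growth of second moments -/

lemma integral_weightedPosition_sq_succ (hX : IsAERW P p q β X α m) (hp0 : 0 ≤ p) (hp1 : p ≤ 1)
    (hq0 : 0 ≤ q) (hq1 : q ≤ 1) (hβ : 0 ≤ β) {n : ℕ} (hn : 1 ≤ n) :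
    ∫ ω, weightedPosition β X (n + 1) ω ^ 2 ∂P =
      (n ^ 2 + 2 * ((2 * p - 1) * (β + 1)) * n) / (n + β) ^ 2 *
        ∫ ω, weightedPosition β X n ω ^ 2 ∂P + 1 := by
  have hn' : (0 : ℝ) < n := by exact_mod_cast hn
  have hZb := hX.memLp_weightedPosition hp0 hp1 hq0 hq1 hβ n
  have h0 := hX.integral_mul_step hp0 hp1 hq0 hq1 hβ hn
    (measurable_past_weightedPosition β X le_rfl) hZb
  have h1 : (fun ω => weightedPosition β X (n + 1) ω ^ 2) =ᵐ[P] fun ω =>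
      ((n : ℝ) / (n + β)) ^ 2 * (weightedPosition β X n ω * weightedPosition β X n ω) +
      2 * ((n : ℝ) / (n + β)) * (weightedPosition β X n ω * X (n + 1) ω) + 1 * 1 := by
    filter_upwards [hX.step_sq_ae hp0 hp1 hq0 hq1 hβ] with ω h
    rw [weightedPosition_succ hβ X hn]
    linear_combination h (n + 1) (Nat.succ_pos n)
  have i1 : Integrable (fun ω => weightedPosition β X n ω * weightedPosition β X n ω) P :=
    (hZb.mul hZb).integrable le_top
  have i2 : Integrable (fun ω => weightedPosition β X n ω * X (n + 1) ω) P :=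
    ((hX.memLp_step hp0 hp1 hq0 hq1 hβ (Nat.succ_pos n)).mul hZb).integrable le_top
  rw [integral_congr_ae h1, integral_linear_comb i1 i2 (integrable_const 1), h0]
  simp only [pow_two (weightedPosition β X n _), integral_const, probReal_univ, one_smul]
  have : (n : ℝ) + β ≠ 0 := by positivity
  field_simp

lemma integral_position_sq_succ (hX : IsAERW P p q β X α m) (hp0 : 0 ≤ p) (hp1 : p ≤ 1)
    (hq0 : 0 ≤ q) (hq1 : q ≤ 1) (hβ : 0 ≤ β) {n : ℕ} (hn : 1 ≤ n) :
    ∫ ω, position X (n + 1) ω ^ 2 ∂P = ∫ ω, position X n ω ^ 2 ∂P +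
      2 * ((2 * p - 1) * (β + 1)) / (n + β) *
        ∫ ω, position X n ω * weightedPosition β X n ω ∂P + 1 := by
  have hSb := hX.memLp_position hp0 hp1 hq0 hq1 hβ n
  have h0 := hX.integral_mul_step hp0 hp1 hq0 hq1 hβ hn
    (measurable_past_position X le_rfl) hSb
  have h1 : (fun ω => position X (n + 1) ω ^ 2) =ᵐ[P] fun ω =>
      1 * (position X n ω * position X n ω) + 2 * (position X n ω * X (n + 1) ω) + 1 * 1 := by
    filter_upwards [hX.step_sq_ae hp0 hp1 hq0 hq1 hβ] with ω h
    rw [position_succ]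
    linear_combination h (n + 1) (Nat.succ_pos n)
  have i1 : Integrable (fun ω => position X n ω * position X n ω) P :=
    (hSb.mul hSb).integrable le_top
  have i2 : Integrable (fun ω => position X n ω * X (n + 1) ω) P :=
    ((hX.memLp_step hp0 hp1 hq0 hq1 hβ (Nat.succ_pos n)).mul hSb).integrable le_top
  rw [integral_congr_ae h1, integral_linear_comb i1 i2 (integrable_const 1), h0]
  simp only [pow_two, integral_const, probReal_univ, one_smul]
  ring

lemma integral_step_sq (hX : IsAERW P p q β X α m) (hp0 : 0 ≤ p) (hp1 : p ≤ 1)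
    (hq0 : 0 ≤ q) (hq1 : q ≤ 1) (hβ : 0 ≤ β) {n : ℕ} (hn : 1 ≤ n) :
    ∫ ω, X n ω ^ 2 ∂P = 1 := by
  have : (fun ω => X n ω ^ 2) =ᵐ[P] fun _ => 1 := by
    filter_upwards [hX.step_sq_ae hp0 hp1 hq0 hq1 hβ] with ω h using h n hn
  rw [integral_congr_ae this]
  simp

/-- In the diffusive regime the weighted position has second moments of linear growth. -/
lemma exists_integral_weightedPosition_sq_le (hX : IsAERW P p q β X α m) (hp0 : 0 ≤ p)
    (hp1 : p ≤ 1) (hq0 : 0 ≤ q) (hq1 : q ≤ 1) (hβ : 0 ≤ β)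
    (hc : 2 * ((2 * p - 1) * (β + 1)) < 2 * β + 1) :
    ∃ K : ℝ, 1 ≤ K ∧ ∀ n, 1 ≤ n → ∫ ω, weightedPosition β X n ω ^ 2 ∂P ≤ K * n := by
  set c := (2 * p - 1) * (β + 1) with hcdef
  -- `δ` is the diffusive gap, capped at 1 to keep the lower-order terms nonnegative. With `K =
  -- δ⁻¹`, the saving `K δ` pays for the `+ 1` of each step.
  obtain ⟨δ, hδ0, hδ1, hδc⟩ : ∃ δ : ℝ, 0 < δ ∧ δ ≤ 1 ∧ δ ≤ 2 * β + 1 - 2 * c :=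
    ⟨min 1 (2 * β + 1 - 2 * c), lt_min one_pos (by linarith), min_le_left _ _, min_le_right _ _⟩
  have hK : 1 ≤ δ⁻¹ := (one_le_inv₀ hδ0).2 hδ1
  refine ⟨δ⁻¹, hK, fun n hn => ?_⟩
  induction n, hn using Nat.le_induction with
  | base =>
    simp only [weightedPosition_one]
    rw [hX.integral_step_sq hp0 hp1 hq0 hq1 hβ le_rfl]
    simpa using hK
  | succ n hn ih =>
    have hn' : (1 : ℝ) ≤ n := by exact_mod_cast hn
    rw [hX.integral_weightedPosition_sq_succ hp0 hp1 hq0 hq1 hβ hn, ← hcdef]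
    have ht : 0 ≤ ∫ ω, weightedPosition β X n ω ^ 2 ∂P := integral_nonneg fun ω => sq_nonneg _
    set t := ∫ ω, weightedPosition β X n ω ^ 2 ∂P
    have hD : 0 < ((n : ℝ) + β) ^ 2 := by positivity
    -- For negative `c` the coefficient may be negative; its term is then simply dropped.
    rcases le_or_gt 0 ((n : ℝ) ^ 2 + 2 * c * n) with h | h
    · have h1 : ((n : ℝ) ^ 2 + 2 * c * n) / (n + β) ^ 2 * t ≤
          ((n : ℝ) ^ 2 + 2 * c * n) / (n + β) ^ 2 * (δ⁻¹ * n) :=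
        mul_le_mul_of_nonneg_left ih (by positivity)
      have h2 : ((n : ℝ) ^ 2 + 2 * c * n) / (n + β) ^ 2 * n ≤ n + 1 - δ := by
        rw [div_mul_eq_mul_div, div_le_iff₀ hD]
        have e1 : 0 ≤ (2 * β + 1 - 2 * c - δ) * (n : ℝ) ^ 2 :=
          mul_nonneg (by linarith) (sq_nonneg _)
        have e2 : 0 ≤ (β ^ 2 + 2 * β * (1 - δ)) * (n : ℝ) :=
          mul_nonneg (add_nonneg (sq_nonneg _) (mul_nonneg (by linarith) (by linarith)))
            (by linarith)
        have e3 : 0 ≤ (1 - δ) * β ^ 2 := mul_nonneg (by linarith) (sq_nonneg _)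
        linarith
      have h3 := mul_le_mul_of_nonneg_left h2 (by positivity : 0 ≤ δ⁻¹)
      have h4 : δ⁻¹ * (n + 1 - δ) = δ⁻¹ * (n + 1) - 1 := by field_simp
      push_cast
      linarith
    · have h1 : ((n : ℝ) ^ 2 + 2 * c * n) / (n + β) ^ 2 * t ≤ 0 :=
        mul_nonpos_of_nonpos_of_nonneg (div_nonpos_of_nonpos_of_nonneg h.le hD.le) ht
      push_cast
      nlinarith

/-- In the diffusive regime the position has second moments of linear growth. -/
lemma exists_integral_position_sq_le (hX : IsAERW P p q β X α m) (hp0 : 0 ≤ p)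
    (hp1 : p ≤ 1) (hq0 : 0 ≤ q) (hq1 : q ≤ 1) (hβ : 0 ≤ β)
    (hc : 2 * ((2 * p - 1) * (β + 1)) < 2 * β + 1) :
    ∃ K : ℝ, 1 ≤ K ∧ ∀ n, 1 ≤ n → ∫ ω, position X n ω ^ 2 ∂P ≤ K * n := by
  obtain ⟨K, hK1, hK⟩ := hX.exists_integral_weightedPosition_sq_le hp0 hp1 hq0 hq1 hβ hc
  set c := (2 * p - 1) * (β + 1) with hcdef
  -- With `L = 1 + 2c²K` and bound `2L n`, the inequality `2c S Z ≤ S²/2 + 2c² Z²` limits the cross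
  -- term to `L + (L - 1)`. Adding 1 gives an increment of at most `2L`.
  refine ⟨2 * (1 + 2 * c ^ 2 * K), by nlinarith [sq_nonneg c], fun n hn => ?_⟩
  have hL : 0 ≤ c ^ 2 * K := by positivity
  induction n, hn using Nat.le_induction with
  | base =>
    simp only [position_one]
    rw [hX.integral_step_sq hp0 hp1 hq0 hq1 hβ le_rfl]
    push_cast
    linarith
  | succ n hn ih =>
    have hn' : (1 : ℝ) ≤ n := by exact_mod_cast hn
    have hSb := hX.memLp_position hp0 hp1 hq0 hq1 hβ n
    have hZb := hX.memLp_weightedPosition hp0 hp1 hq0 hq1 hβ n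
    have i1 : Integrable (fun ω => position X n ω ^ 2) P := by
      simp only [pow_two]
      exact (hSb.mul hSb).integrable le_top
    have i2 : Integrable (fun ω => weightedPosition β X n ω ^ 2) P := by
      simp only [pow_two]
      exact (hZb.mul hZb).integrable le_top
    have i3 : Integrable (fun ω => position X n ω * weightedPosition β X n ω) P :=
      (hZb.mul hSb).integrable le_top
    have h1 : 2 * c * ∫ ω, position X n ω * weightedPosition β X n ω ∂P ≤
        2⁻¹ * ∫ ω, position X n ω ^ 2 ∂P +
          2 * c ^ 2 * ∫ ω, weightedPosition β X n ω ^ 2 ∂P := by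
      rw [← integral_const_mul, ← integral_const_mul, ← integral_const_mul,
        ← integral_add (i1.const_mul _) (i2.const_mul _)]
      refine integral_mono (i3.const_mul _) ((i1.const_mul _).add (i2.const_mul _)) fun ω => ?_
      simp only
      nlinarith [sq_nonneg (position X n ω - 2 * c * weightedPosition β X n ω)]
    rw [hX.integral_position_sq_succ hp0 hp1 hq0 hq1 hβ hn, ← hcdef]
    have h2 : 2 * c ^ 2 * ∫ ω, weightedPosition β X n ω ^ 2 ∂P ≤ 2 * c ^ 2 * (K * n) :=
      mul_le_mul_of_nonneg_left (hK n hn) (by positivity)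
    have h3 : 2 * c / (n + β) * ∫ ω, position X n ω * weightedPosition β X n ω ∂P ≤
        (1 + 2 * c ^ 2 * K) + 2 * c ^ 2 * K := by
      rw [div_mul_eq_mul_div, div_le_iff₀ (by positivity)]
      have : 0 ≤ ((1 + 2 * c ^ 2 * K) + 2 * c ^ 2 * K) * β := mul_nonneg (by linarith) hβ
      linarith
    push_cast
    linarith

end IsAERW

/-! ### Reduction to a sparse subsequence -/

/-- If `T` is nonnegative and nondecreasing, the convergence of `T n / log n` follows from its
convergence along `n = 2 ^ (j ^ 2)`. -/
lemma tendsto_div_log_of_monotone {T : ℕ → ℝ} (hT : Monotone T) (hT0 : ∀ n, 0 ≤ T n) {L : ℝ}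
    (h : Tendsto (fun j : ℕ => T (2 ^ j ^ 2) / ((j : ℝ) + 1) ^ 2) atTop (𝓝 (L * Real.log 2))) :
    Tendsto (fun n : ℕ => T n / Real.log n) atTop (𝓝 L) := by
  have hl2 : 0 < Real.log 2 := Real.log_pos one_lt_two
  -- For `j = ⌊√⌊log₂ n⌋⌋` one has `2 ^ j² ≤ n ≤ 2 ^ (j + 1)²`, which sandwiches both `T n` and `log
  -- n`.
  have hj : Tendsto (fun n => Nat.sqrt (Nat.log 2 n)) atTop atTop := by
    refine tendsto_atTop.2 fun b => ?_
    filter_upwards [eventually_ge_atTop (2 ^ (b * b))] with n hn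
    have : b * b ≤ Nat.log 2 n := by
      have h := Nat.log_mono_right (b := 2) hn
      rwa [Nat.log_pow one_lt_two] at h
    exact Nat.le_sqrt.2 this
  have hlow : Tendsto (fun j : ℕ => T (2 ^ j ^ 2) / ((j : ℝ) + 1) ^ 2 / Real.log 2) atTop
      (𝓝 L) := by
    have := h.div_const (Real.log 2)
    rwa [mul_div_cancel_right₀ _ hl2.ne'] at this
  have hup : Tendsto (fun j : ℕ => T (2 ^ (j + 1) ^ 2) / (j : ℝ) ^ 2 / Real.log 2) atTop
      (𝓝 L) := by
    -- This is `((j + 2) / j)²`, which trades the shifted denominator `(j + 2)²` for `j²`.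
    have h1 : Tendsto (fun j : ℕ => (1 + 2 * (1 / (j : ℝ))) ^ 2) atTop (𝓝 1) := by
      simpa using ((tendsto_one_div_atTop_nhds_zero_nat (𝕜 := ℝ)).const_mul 2 |>.const_add 1).pow 2
    have h2 := (hlow.comp (tendsto_add_atTop_nat 1)).mul h1
    rw [mul_one] at h2
    refine h2.congr' ?_
    filter_upwards [eventually_ge_atTop 1] with j hj
    have : (0 : ℝ) < j := by exact_mod_cast hj
    simp only [Function.comp_apply]
    push_cast
    field_simp
    ring
  refine tendsto_of_tendsto_of_tendsto_of_le_of_le' (hlow.comp hj) (hup.comp hj) ?_ ?_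
  all_goals
    filter_upwards [eventually_ge_atTop 2] with n hn
    have hlog : 1 ≤ Nat.log 2 n := Nat.log_pos one_lt_two hn
    have hj1 : 1 ≤ Nat.sqrt (Nat.log 2 n) := Nat.le_sqrt.2 (by simpa using hlog)
    have hlt := Nat.lt_succ_sqrt' (Nat.log 2 n)
    have hle := Nat.sqrt_le' (Nat.log 2 n)
    simp only [Function.comp_apply]
    set j := Nat.sqrt (Nat.log 2 n)
    have hn1 : 2 ^ j ^ 2 ≤ n := (Nat.pow_le_pow_right two_pos hle).trans
      (Nat.pow_log_le_self 2 (by omega))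
    have hn2 : n ≤ 2 ^ (j + 1) ^ 2 := (Nat.lt_pow_succ_log_self one_lt_two n).le.trans
      (Nat.pow_le_pow_right two_pos hlt)
    have hj0 : (1 : ℝ) ≤ j := by exact_mod_cast hj1
    have hn0 : (0 : ℝ) < n := by exact_mod_cast (by omega : 0 < n)
    have hl1 : (j : ℝ) ^ 2 * Real.log 2 ≤ Real.log n := by
      have : Real.log ((2 : ℝ) ^ j ^ 2) ≤ Real.log n :=
        Real.log_le_log (by positivity) (by exact_mod_cast hn1)
      rw [Real.log_pow] at this
      exact_mod_cast this
    have hl2' : Real.log n ≤ ((j : ℝ) + 1) ^ 2 * Real.log 2 := by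
      have : Real.log n ≤ Real.log ((2 : ℝ) ^ (j + 1) ^ 2) :=
        Real.log_le_log hn0 (by exact_mod_cast hn2)
      rw [Real.log_pow] at this
      exact_mod_cast this
    have hpos : 0 < (j : ℝ) ^ 2 * Real.log 2 := by positivity
    rw [div_div]
  · exact div_le_div₀ (hT0 _) (hT hn1) (hpos.trans_le hl1) hl2'
  · exact div_le_div₀ (hT0 _) (hT hn2) hpos hl1

/-- Summable means force `∑ f j` to be finite almost everywhere, so its terms tend to zero. -/
lemma ae_tendsto_zero_of_integral_le {Ω : Type*} [MeasurableSpace Ω] {P : Measure Ω}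
    {f : ℕ → Ω → ℝ} (hf0 : ∀ j ω, 0 ≤ f j ω) (hf : ∀ j, Integrable (f j) P) {C : ℝ}
    (hC : ∀ j : ℕ, ∫ ω, f j ω ∂P ≤ C / ((j : ℝ) + 1) ^ 2) :
    ∀ᵐ ω ∂P, Tendsto (fun j => f j ω) atTop (𝓝 0) := by
  have hsum : Summable fun j : ℕ => C / ((j : ℝ) + 1) ^ 2 := by
    have h := (summable_nat_add_iff 1).2 (Real.summable_one_div_nat_pow.2 one_lt_two)
    refine (h.mul_left C).congr fun j => ?_
    push_cast
    ring
  have hsum' : Summable fun j => ∫ ω, f j ω ∂P :=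
    Summable.of_nonneg_of_le (fun j => integral_nonneg (hf0 j)) hC hsum
  have hfin : ∫⁻ ω, ∑' j, ENNReal.ofReal (f j ω) ∂P ≠ ⊤ := by
    rw [lintegral_tsum fun j => (hf j).aestronglyMeasurable.aemeasurable.ennreal_ofReal]
    have : ∀ j, ∫⁻ ω, ENNReal.ofReal (f j ω) ∂P = ENNReal.ofReal (∫ ω, f j ω ∂P) := fun j =>
      (ofReal_integral_eq_lintegral_ofReal (hf j) (ae_of_all _ (hf0 j))).symm
    simp only [this]
    exact hsum'.tsum_ofReal_ne_top
  have hmeas : AEMeasurable (fun ω => ∑' j, ENNReal.ofReal (f j ω)) P :=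
    AEMeasurable.tsum fun j => (hf j).aestronglyMeasurable.aemeasurable.ennreal_ofReal
  filter_upwards [ae_lt_top' hmeas hfin] with ω h
  have h1 := ENNReal.tendsto_atTop_zero_of_tsum_ne_top h.ne
  have h2 := (ENNReal.tendsto_toReal ENNReal.zero_ne_top).comp h1
  simpa [Function.comp_def, ENNReal.toReal_ofReal, hf0] using h2

/-! ### The quadratic recursion -/

/-- One step of the recursion for the quadratic form `(x Z ^ 2 + 2 y Z S + S ^ 2) / n`, whose
coefficients are chosen so that its drift is `-S ^ 2 / n ^ 2` to leading order. -/
lemma quadratic_recursion {n β c x y Z S X e : ℝ} (hn : 0 < n) (hβ : 0 ≤ β)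
    (hy : y * (β + 1 - c) = c) (hx : x * (2 * β + 1 - 2 * c) = 2 * y * c)
    (he : X = e + c / (n + β) * Z) (hX : X ^ 2 = 1) :
    S ^ 2 / n ^ 2 = (x + 2 * y + 1) * (1 / (n + 1)) +
      ((x * Z ^ 2 + 2 * y * Z * S + S ^ 2) / n -
        (x * (n / (n + β) * Z + X) ^ 2 + 2 * y * (n / (n + β) * Z + X) * (S + X) + (S + X) ^ 2)
          / (n + 1)) +
      (2 * (x + y) * (n / (n + β)) / (n + 1) * Z + 2 * (y + 1) / (n + 1) * S) * e +
      (-x * ((β ^ 2 + 2 * β) * n + β ^ 2) / ((n + β) ^ 2 * (n + 1) * n) * Z ^ 2 +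
        -2 * y * β / ((n + β) * (n + 1) * n) * (Z * S) + 1 / (n ^ 2 * (n + 1)) * S ^ 2) := by
  have hnβ : n + β ≠ 0 := by positivity
  have hn1 : n + 1 ≠ 0 := by positivity
  -- `hA`, `hB`, `hC` treat the coefficients of `Z²`, `Z S`, `S²` in the drift. The `n⁻²` parts
  -- cancel by the equation for `x`, by the equation for `y`, and against `S² / n²` respectively.
  have hA : (x * ((n / (n + β)) ^ 2 + 2 * (n / (n + β)) * (c / (n + β))) +
      2 * y * (n / (n + β)) * (c / (n + β))) / (n + 1) - x / n =
      -x * ((β ^ 2 + 2 * β) * n + β ^ 2) / ((n + β) ^ 2 * (n + 1) * n) := by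
    field_simp
    linear_combination -n ^ 2 * hx
  have hB : (2 * y * (n / (n + β) + c / (n + β)) + 2 * (c / (n + β))) / (n + 1) - 2 * y / n =
      -2 * y * β / ((n + β) * (n + 1) * n) := by
    field_simp
    linear_combination -n * hy
  have hC : 1 / (n + 1) - 1 / n + 1 / n ^ 2 = 1 / (n ^ 2 * (n + 1)) := by
    field_simp
    ring
  linear_combination (Z ^ 2) * hA + (Z * S) * hB + S ^ 2 * hC + (x + 2 * y + 1) / (n + 1) * hX +
    2 * (x * (n / (n + β)) * Z + y * (n / (n + β) * Z + S) + S) / (n + 1) * he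


/-! ### Harmonic sums -/

lemma sum_Icc_one_div_le (n : ℕ) : ∑ k ∈ Finset.Icc 1 n, 1 / (k : ℝ) ≤ 1 + Real.log n := by
  have h := harmonic_le_one_add_log n
  rw [harmonic_eq_sum_Icc] at h
  push_cast at h
  simpa using h

lemma abs_sum_Icc_one_div_succ_sub_log_le {n : ℕ} (hn : 1 ≤ n) :
    |∑ k ∈ Finset.Icc 1 n, 1 / ((k : ℝ) + 1) - Real.log n| ≤ 1 := by
  have h1 := sum_Icc_one_div_le n
  have h2 := log_add_one_le_harmonic n
  rw [harmonic_eq_sum_Icc] at h2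
  push_cast at h2
  have h3 : ∑ k ∈ Finset.Icc 1 n, 1 / ((k : ℝ) + 1) =
      ∑ k ∈ Finset.Icc 1 n, 1 / (k : ℝ) + 1 / ((n : ℝ) + 1) - 1 := by
    clear h1 h2 hn
    induction n with
    | zero => simp
    | succ n ih =>
      rw [Finset.sum_Icc_succ_top (by omega), Finset.sum_Icc_succ_top (by omega), ih]
      push_cast
      ring
  have hn' : (1 : ℝ) ≤ n := by exact_mod_cast hn
  have h4 : Real.log n ≤ Real.log ((n : ℝ) + 1) := Real.log_le_log (by linarith) (by linarith)
  have h5 : 0 < 1 / ((n : ℝ) + 1) := by positivity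
  have h6 : 1 / ((n : ℝ) + 1) ≤ 1 := by
    rw [div_le_one (by positivity)]
    linarith
  simp only [one_div] at *
  rw [h3, abs_le]
  constructor <;> linarith

lemma tendsto_sum_one_div_succ_along_two_pow_sq :
    Tendsto (fun j : ℕ => (∑ k ∈ Finset.Icc 1 ((2 : ℕ) ^ j ^ 2), 1 / ((k : ℝ) + 1)) / ((j : ℝ) + 1) ^ 2)
      atTop (𝓝 (Real.log 2)) := by
  have h0 : Tendsto (fun j : ℕ => 1 / ((j : ℝ) + 1)) atTop (𝓝 0) :=
    tendsto_one_div_add_atTop_nhds_zero_nat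
  have h1 : Tendsto (fun j : ℕ => (1 - 1 / ((j : ℝ) + 1)) ^ 2 * Real.log 2) atTop
      (𝓝 (Real.log 2)) := by
    simpa using ((h0.const_sub 1).pow 2).mul_const (Real.log 2)
  have h2 : Tendsto (fun j : ℕ => (1 / ((j : ℝ) + 1)) ^ 2) atTop (𝓝 0) := by
    simpa using h0.pow 2
  have hlow := h1.sub h2
  have hup := h1.add h2
  rw [sub_zero] at hlow
  rw [add_zero] at hup
  refine tendsto_of_tendsto_of_tendsto_of_le_of_le hlow hup (fun j => ?_) fun j => ?_
  all_goals
    have h := abs_le.1 (abs_sum_Icc_one_div_succ_sub_log_le (Nat.one_le_two_pow (n := j ^ 2)))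
    rw [Nat.cast_pow, Real.log_pow] at h
    push_cast at h
    have hj : (0 : ℝ) < ((j : ℝ) + 1) ^ 2 := by positivity
    have e : (1 - 1 / ((j : ℝ) + 1)) ^ 2 * Real.log 2 = j ^ 2 * Real.log 2 / ((j : ℝ) + 1) ^ 2 := by
      field_simp
      ring
    have e2 : (1 / ((j : ℝ) + 1)) ^ 2 = 1 / ((j : ℝ) + 1) ^ 2 := by
      rw [div_pow, one_pow]
    simp only [e, e2]
  · rw [← sub_div]
    exact div_le_div_of_nonneg_right (by linarith) hj.le
  · rw [← add_div]
    exact div_le_div_of_nonneg_right (by linarith) hj.le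

lemma exists_sum_Icc_one_div_sq_le : ∃ B : ℝ,
    ∀ n : ℕ, ∑ k ∈ Finset.Icc 1 n, 1 / (k : ℝ) ^ 2 ≤ B := by
  have h := Real.summable_one_div_nat_pow.2 one_lt_two
  exact ⟨∑' k : ℕ, 1 / (k : ℝ) ^ 2,
    fun n => h.sum_le_tsum _ fun k _ => by positivity⟩

/-! ### Pointwise bounds and the summed identity -/

/-- The quadratic functional `(x Z ^ 2 + 2 y Z S + S ^ 2) / n` of the walk. -/
noncomputable def quadratic {Ω : Type*} (β x y : ℝ) (X : ℕ → Ω → ℝ) (n : ℕ) (ω : Ω) : ℝ :=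
  (x * weightedPosition β X n ω ^ 2 + 2 * y * weightedPosition β X n ω * position X n ω +
    position X n ω ^ 2) / n

/-- The predictable factor of the martingale part in the recursion of `quadratic`. -/
noncomputable def predictable {Ω : Type*} (β x y : ℝ) (X : ℕ → Ω → ℝ) (n : ℕ) (ω : Ω) : ℝ :=
  2 * (x + y) * (n / (n + β)) / (n + 1) * weightedPosition β X n ω +
    2 * (y + 1) / (n + 1) * position X n ω

/-- The lower order terms in the recursion of `quadratic`. -/
noncomputable def remainder {Ω : Type*} (β x y : ℝ) (X : ℕ → Ω → ℝ) (n : ℕ) (ω : Ω) : ℝ :=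
  -x * ((β ^ 2 + 2 * β) * n + β ^ 2) / ((n + β) ^ 2 * (n + 1) * n) *
      weightedPosition β X n ω ^ 2 +
    -2 * y * β / ((n + β) * (n + 1) * n) * (weightedPosition β X n ω * position X n ω) +
    1 / (n ^ 2 * (n + 1)) * position X n ω ^ 2

lemma abs_quadratic_le {Ω : Type*} (β x y : ℝ) (X : ℕ → Ω → ℝ) (n : ℕ) (ω : Ω) :
    |quadratic β x y X n ω| ≤
      (|x| + |y| + 1) / n * (weightedPosition β X n ω ^ 2 + position X n ω ^ 2) := by
  rw [quadratic]
  set Z := weightedPosition β X n ω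
  set S := position X n ω
  rw [abs_div, abs_of_nonneg (Nat.cast_nonneg (α := ℝ) n), div_mul_eq_mul_div]
  refine div_le_div_of_nonneg_right ?_ (Nat.cast_nonneg _)
  have h1 : |x * Z ^ 2| = |x| * Z ^ 2 := by rw [abs_mul, abs_of_nonneg (sq_nonneg Z)]
  have h2 : |2 * y * Z * S| ≤ |y| * (Z ^ 2 + S ^ 2) := by
    have : 2 * y * Z * S = y * (2 * (Z * S)) := by ring
    rw [this, abs_mul]
    refine mul_le_mul_of_nonneg_left ?_ (abs_nonneg y)
    rw [abs_le]
    constructor <;> nlinarith [sq_nonneg (Z - S), sq_nonneg (Z + S)]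
  have h3 : |S ^ 2| = S ^ 2 := abs_of_nonneg (sq_nonneg S)
  have := abs_add_three (x * Z ^ 2) (2 * y * Z * S) (S ^ 2)
  nlinarith [mul_nonneg (abs_nonneg x) (sq_nonneg S), sq_nonneg Z]

/-- The power `n⁻³` against moments of order `n` leaves the summable `n⁻²`. -/
lemma abs_remainder_le {Ω : Type*} {β : ℝ} (hβ : 0 ≤ β) (x y : ℝ) (X : ℕ → Ω → ℝ) {n : ℕ}
    (hn : 1 ≤ n) (ω : Ω) :
    |remainder β x y X n ω| ≤ (|x| * (2 * β ^ 2 + 2 * β) + |y| * β + 1) / n ^ 3 *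
      (weightedPosition β X n ω ^ 2 + position X n ω ^ 2) := by
  rw [remainder]
  set Z := weightedPosition β X n ω
  set S := position X n ω
  have hn1 : (1 : ℝ) ≤ n := by exact_mod_cast hn
  have hn0 : (0 : ℝ) < n := by linarith
  have hA : |-x * ((β ^ 2 + 2 * β) * n + β ^ 2) / ((n + β) ^ 2 * (n + 1) * n)| ≤
      |x| * (2 * β ^ 2 + 2 * β) / n ^ 3 := by
    have hD : (0 : ℝ) < (n + β) ^ 2 * (n + 1) * n := by positivity
    have hN : 0 ≤ (β ^ 2 + 2 * β) * (n : ℝ) + β ^ 2 := by positivity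
    rw [abs_div, abs_mul, abs_neg, abs_of_nonneg hN, abs_of_pos hD]
    have e : |x| * (2 * β ^ 2 + 2 * β) / (n : ℝ) ^ 3 =
        |x| * ((2 * β ^ 2 + 2 * β) * n) / ((n : ℝ) ^ 2 * n * n) := by
      field_simp
    rw [e]
    refine div_le_div₀ (by positivity) (mul_le_mul_of_nonneg_left ?_ (abs_nonneg x))
      (by positivity) ?_
    · nlinarith [mul_nonneg (sq_nonneg β) (sub_nonneg.2 hn1)]
    · gcongr <;> linarith
  have hB : |-2 * y * β / (((n : ℝ) + β) * (n + 1) * n)| ≤ 2 * (|y| * β / n ^ 3) := by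
    have hD : (0 : ℝ) < (n + β) * (n + 1) * n := by positivity
    rw [abs_div, abs_mul, abs_mul, abs_of_nonneg hβ, abs_of_pos hD]
    have e : 2 * (|y| * β / (n : ℝ) ^ 3) = |(-2 : ℝ)| * |y| * β / ((n : ℝ) * n * n) := by
      rw [abs_neg, abs_two]
      field_simp
    rw [e]
    refine div_le_div_of_nonneg_left (by positivity) (by positivity) ?_
    gcongr <;> linarith
  have hC : |1 / ((n : ℝ) ^ 2 * (n + 1))| ≤ 1 / (n : ℝ) ^ 3 := by
    rw [abs_of_nonneg (by positivity)]
    refine one_div_le_one_div_of_le (by positivity) ?_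
    nlinarith [sq_nonneg (n : ℝ)]
  refine (abs_add_three _ _ _).trans ?_
  rw [abs_mul _ (Z ^ 2), abs_mul _ (Z * S), abs_mul _ (S ^ 2), abs_of_nonneg (sq_nonneg Z), abs_of_nonneg (sq_nonneg S)]
  have hZS : 2 * |Z * S| ≤ Z ^ 2 + S ^ 2 := by
    rw [abs_mul, ← sq_abs Z, ← sq_abs S]
    nlinarith [sq_nonneg (|Z| - |S|)]
  have a1 := mul_le_mul_of_nonneg_right hA (sq_nonneg Z)
  have a2 := mul_le_mul_of_nonneg_right hB (abs_nonneg (Z * S))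
  have a3 := mul_le_mul_of_nonneg_right hC (sq_nonneg S)
  have b1 : 0 ≤ |x| * (2 * β ^ 2 + 2 * β) / (n : ℝ) ^ 3 * S ^ 2 := by positivity
  have b2 := mul_le_mul_of_nonneg_left hZS (by positivity : 0 ≤ |y| * β / (n : ℝ) ^ 3)
  have b3 : 0 ≤ 1 / (n : ℝ) ^ 3 * Z ^ 2 := by positivity
  rw [add_div, add_div]
  linarith

/-- The power `n⁻²` against moments of order `n` gives `1 / n`, hence logarithmic variance for the
martingale. -/
lemma predictable_sq_le {Ω : Type*} {β : ℝ} (hβ : 0 ≤ β) (x y : ℝ) (X : ℕ → Ω → ℝ) {n : ℕ}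
    (hn : 1 ≤ n) (ω : Ω) :
    predictable β x y X n ω ^ 2 ≤ (8 * ((x + y) ^ 2 + (y + 1) ^ 2)) / n ^ 2 *
      (weightedPosition β X n ω ^ 2 + position X n ω ^ 2) := by
  rw [predictable]
  set Z := weightedPosition β X n ω
  set S := position X n ω
  have hn1 : (1 : ℝ) ≤ n := by exact_mod_cast hn
  have hn0 : (0 : ℝ) < n := by linarith
  have e : 2 * (x + y) * (n / (n + β)) / (n + 1) * Z + 2 * (y + 1) / (n + 1) * S =
      2 * ((x + y) * (n / (n + β) * Z) + (y + 1) * S) / ((n : ℝ) + 1) := by ring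
  have hr0 : 0 ≤ (n : ℝ) / (n + β) := by positivity
  have hr1 : (n : ℝ) / (n + β) ≤ 1 := by
    rw [div_le_one (by positivity)]
    linarith
  rw [e]
  generalize (n : ℝ) / (n + β) = r at hr0 hr1 ⊢
  rw [div_pow, div_mul_eq_mul_div]
  refine div_le_div₀ (by positivity) ?_ (by positivity) (by gcongr; linarith)
  have hr2 : (r * Z) ^ 2 ≤ Z ^ 2 := by
    rw [mul_pow]
    exact mul_le_of_le_one_left (sq_nonneg Z) (pow_le_one₀ hr0 hr1)
  have c1 : ((x + y) * (r * Z) + (y + 1) * S) ^ 2 ≤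
      2 * ((x + y) ^ 2 * (r * Z) ^ 2 + (y + 1) ^ 2 * S ^ 2) := by
    nlinarith [sq_nonneg ((x + y) * (r * Z) - (y + 1) * S)]
  have c2 := mul_le_mul_of_nonneg_left hr2 (sq_nonneg (x + y))
  have c3 := mul_nonneg (sq_nonneg (x + y)) (sq_nonneg S)
  have c4 := mul_nonneg (sq_nonneg (y + 1)) (sq_nonneg Z)
  rw [mul_pow]
  linarith

lemma measurable_past_predictable {Ω : Type*} {β : ℝ} {X : ℕ → Ω → ℝ} (x y : ℝ) {n k : ℕ} (hk : k ≤ n) :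
    Measurable[past X n] (predictable β x y X k) := by
  let _ := past X n
  exact ((measurable_past_weightedPosition β X hk).const_mul _).add
    ((measurable_past_position X hk).const_mul _)

/-- Summed form of `quadratic_recursion` along the walk. -/
lemma sum_position_sq_div_eq {Ω : Type*} {p β : ℝ} {X : ℕ → Ω → ℝ} {c x y : ℝ} (hβ : 0 ≤ β) (hc : c = (2 * p - 1) * (β + 1))
    (hy : y * (β + 1 - c) = c) (hx : x * (2 * β + 1 - 2 * c) = 2 * y * c) {ω : Ω}
    (h : ∀ n, 1 ≤ n → X n ω ^ 2 = 1) (n : ℕ) :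
    ∑ k ∈ Finset.Icc 1 n, position X k ω ^ 2 / (k : ℝ) ^ 2 =
      (x + 2 * y + 1) * ∑ k ∈ Finset.Icc 1 n, 1 / ((k : ℝ) + 1) +
      (quadratic β x y X 1 ω - quadratic β x y X (n + 1) ω) +
      ∑ k ∈ Finset.Icc 1 n, predictable β x y X k ω * innovation p β X k ω +
      ∑ k ∈ Finset.Icc 1 n, remainder β x y X k ω := by
  induction n with
  | zero => simp
  | succ n ih =>
    have hstep := quadratic_recursion (n := ((n + 1 : ℕ) : ℝ))
      (Z := weightedPosition β X (n + 1) ω) (S := position X (n + 1) ω)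
      (X := X (n + 1 + 1) ω) (e := innovation p β X (n + 1) ω) (by positivity) hβ hy hx
      (by rw [innovation, hc]; ring) (h _ (by omega))
    rw [← weightedPosition_succ hβ X (by omega), ← position_succ] at hstep
    simp only [Finset.sum_Icc_succ_top (show 1 ≤ n + 1 by omega), ih, mul_add]
    rw [hstep, predictable, remainder]
    have e1 : quadratic β x y X (n + 1 + 1) ω = (x * weightedPosition β X (n + 1 + 1) ω ^ 2 +
        2 * y * weightedPosition β X (n + 1 + 1) ω * position X (n + 1 + 1) ω +
        position X (n + 1 + 1) ω ^ 2) / (((n + 1 : ℕ) : ℝ) + 1) := by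
      rw [quadratic]
      push_cast
      rfl
    rw [e1]
    rw [quadratic.eq_1 β x y X (n + 1)]
    ring

/-! ### Almost sure vanishing of the error terms -/

namespace IsAERW

variable {Ω : Type*} [MeasurableSpace Ω] {P : Measure Ω}
  {p q β : ℝ} {X : ℕ → Ω → ℝ} {α : ℕ → Ω → ℝ} {m : ℕ → Ω → ℕ}

lemma measurable_position (hX : IsAERW P p q β X α m) (n : ℕ) : Measurable (position X n) :=
  (measurable_past_position X le_rfl).mono (hX.past_le n) le_rfl

lemma measurable_weightedPosition (hX : IsAERW P p q β X α m) (n : ℕ) :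
    Measurable (weightedPosition β X n) :=
  (measurable_past_weightedPosition β X le_rfl).mono (hX.past_le n) le_rfl

lemma measurable_quadratic (hX : IsAERW P p q β X α m) (x y : ℝ) (n : ℕ) :
    Measurable (quadratic β x y X n) := by
  have h1 := hX.measurable_position n
  have h2 := hX.measurable_weightedPosition n
  unfold quadratic
  fun_prop

lemma measurable_remainder (hX : IsAERW P p q β X α m) (x y : ℝ) (n : ℕ) :
    Measurable (remainder β x y X n) := by
  have h1 := hX.measurable_position n
  have h2 := hX.measurable_weightedPosition n
  unfold remainder
  fun_prop

variable [IsProbabilityMeasure P]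

lemma exists_integral_sq_add_sq_le (hX : IsAERW P p q β X α m) (hp0 : 0 ≤ p)
    (hp1 : p ≤ 1) (hq0 : 0 ≤ q) (hq1 : q ≤ 1) (hβ : 0 ≤ β)
    (hc : 2 * ((2 * p - 1) * (β + 1)) < 2 * β + 1) :
    ∃ K : ℝ, 0 ≤ K ∧
      (∀ n, Integrable (fun ω => weightedPosition β X n ω ^ 2 + position X n ω ^ 2) P) ∧
      ∀ n, 1 ≤ n → ∫ ω, (weightedPosition β X n ω ^ 2 + position X n ω ^ 2) ∂P ≤ K * n := by
  obtain ⟨K₁, hK₁, h₁⟩ := hX.exists_integral_weightedPosition_sq_le hp0 hp1 hq0 hq1 hβ hc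
  obtain ⟨K₂, hK₂, h₂⟩ := hX.exists_integral_position_sq_le hp0 hp1 hq0 hq1 hβ hc
  have i1 : ∀ n, Integrable (fun ω => weightedPosition β X n ω ^ 2) P := fun n => by
    have hb := hX.memLp_weightedPosition hp0 hp1 hq0 hq1 hβ n
    simp only [pow_two]
    exact (hb.mul hb).integrable le_top
  have i2 : ∀ n, Integrable (fun ω => position X n ω ^ 2) P := fun n => by
    have hb := hX.memLp_position hp0 hp1 hq0 hq1 hβ n
    simp only [pow_two]
    exact (hb.mul hb).integrable le_top
  refine ⟨K₁ + K₂, by linarith, fun n => (i1 n).add (i2 n), fun n hn => ?_⟩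
  rw [integral_add (i1 n) (i2 n)]
  linarith [h₁ n hn, h₂ n hn]

lemma memLp_predictable (hX : IsAERW P p q β X α m) (hp0 : 0 ≤ p)
    (hp1 : p ≤ 1) (hq0 : 0 ≤ q) (hq1 : q ≤ 1) (hβ : 0 ≤ β) (x y : ℝ) (n : ℕ) :
    MemLp (predictable β x y X n) ⊤ P :=
  ((hX.memLp_weightedPosition hp0 hp1 hq0 hq1 hβ n).const_mul _).add
    ((hX.memLp_position hp0 hp1 hq0 hq1 hβ n).const_mul _)

/-- The mean of `|Q n|` is bounded uniformly in `n`, so the times `N j` can be arbitrary; both ends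
of the telescoped sum are covered. -/
lemma ae_tendsto_quadratic (hX : IsAERW P p q β X α m) (hp0 : 0 ≤ p)
    (hp1 : p ≤ 1) (hq0 : 0 ≤ q) (hq1 : q ≤ 1) (hβ : 0 ≤ β)
    (hc : 2 * ((2 * p - 1) * (β + 1)) < 2 * β + 1) (x y : ℝ) (N : ℕ → ℕ) (hN : ∀ j, 1 ≤ N j) :
    ∀ᵐ ω ∂P, Tendsto (fun j => quadratic β x y X (N j) ω / ((j : ℝ) + 1) ^ 2) atTop (𝓝 0) := by
  obtain ⟨K, hK0, hKi, hK⟩ := hX.exists_integral_sq_add_sq_le hp0 hp1 hq0 hq1 hβ hc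
  have hi : ∀ n, Integrable (fun ω => |quadratic β x y X n ω|) P := fun n =>
    (((hKi n).const_mul _).mono' (hX.measurable_quadratic x y n).aestronglyMeasurable
      (ae_of_all _ fun ω => abs_quadratic_le β x y X n ω)).abs
  have h := ae_tendsto_zero_of_integral_le (P := P) (C := (|x| + |y| + 1) * K)
    (f := fun j ω => |quadratic β x y X (N j) ω| / ((j : ℝ) + 1) ^ 2)
    (fun j ω => by positivity) (fun j => (hi _).div_const _) fun j => by
      rw [integral_div]
      refine div_le_div_of_nonneg_right ?_ (by positivity)
      have hn : (0 : ℝ) < N j := by exact_mod_cast hN j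
      refine (integral_mono (hi _) ((hKi _).const_mul _)
        fun ω => abs_quadratic_le β x y X (N j) ω).trans ?_
      rw [integral_const_mul]
      refine (mul_le_mul_of_nonneg_left (hK _ (hN j)) (by positivity)).trans_eq ?_
      field_simp
  filter_upwards [h] with ω h
  refine (tendsto_zero_iff_abs_tendsto_zero _).2 (h.congr fun j => ?_)
  rw [Function.comp_apply, abs_div, abs_of_nonneg (by positivity : 0 ≤ ((j : ℝ) + 1) ^ 2)]

lemma ae_tendsto_sum_remainder (hX : IsAERW P p q β X α m) (hp0 : 0 ≤ p)
    (hp1 : p ≤ 1) (hq0 : 0 ≤ q) (hq1 : q ≤ 1) (hβ : 0 ≤ β)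
    (hc : 2 * ((2 * p - 1) * (β + 1)) < 2 * β + 1) (x y : ℝ) (N : ℕ → ℕ) :
    ∀ᵐ ω ∂P, Tendsto (fun j => (∑ k ∈ Finset.Icc 1 (N j), remainder β x y X k ω) /
      ((j : ℝ) + 1) ^ 2) atTop (𝓝 0) := by
  obtain ⟨K, hK0, hKi, hK⟩ := hX.exists_integral_sq_add_sq_le hp0 hp1 hq0 hq1 hβ hc
  obtain ⟨B, hB⟩ := exists_sum_Icc_one_div_sq_le
  set L := |x| * (2 * β ^ 2 + 2 * β) + |y| * β + 1 with hL
  have hL0 : 0 ≤ L := by positivity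
  have hi : ∀ n ∈ {n : ℕ | 1 ≤ n}, Integrable (fun ω => |remainder β x y X n ω|) P := fun n hn =>
    (((hKi n).const_mul _).mono' (hX.measurable_remainder x y n).aestronglyMeasurable
      (ae_of_all _ fun ω => abs_remainder_le hβ x y X hn ω)).abs
  have hi' : ∀ n : ℕ, Integrable (fun ω => ∑ k ∈ Finset.Icc 1 n, |remainder β x y X k ω|) P :=
    fun n => integrable_finsetSum _ fun k hk => hi k (Finset.mem_Icc.1 hk).1
  have h := ae_tendsto_zero_of_integral_le (P := P) (C := L * K * B)
    (f := fun j ω => (∑ k ∈ Finset.Icc 1 (N j), |remainder β x y X k ω|) / ((j : ℝ) + 1) ^ 2)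
    (fun j ω => by positivity) (fun j => (hi' _).div_const _) fun j => by
      rw [integral_div]
      refine div_le_div_of_nonneg_right ?_ (by positivity)
      rw [integral_finsetSum _ fun k hk => hi k (Finset.mem_Icc.1 hk).1]
      refine (Finset.sum_le_sum (g := fun k : ℕ => L * K * (1 / (k : ℝ) ^ 2))
        fun k hk => ?_).trans ?_
      · have hk1 := (Finset.mem_Icc.1 hk).1
        have hn : (0 : ℝ) < k := by exact_mod_cast hk1
        refine (integral_mono (hi k hk1) ((hKi _).const_mul _)
          fun ω => abs_remainder_le hβ x y X hk1 ω).trans ?_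
        rw [integral_const_mul]
        refine (mul_le_mul_of_nonneg_left (hK _ hk1) (by positivity)).trans_eq ?_
        rw [hL]
        field_simp
      · rw [← Finset.mul_sum]
        exact mul_le_mul_of_nonneg_left (hB (N j)) (mul_nonneg hL0 hK0)
  filter_upwards [h] with ω h
  refine squeeze_zero_norm (fun j => ?_) h
  rw [Real.norm_eq_abs, abs_div, abs_of_nonneg (by positivity : 0 ≤ ((j : ℝ) + 1) ^ 2)]
  exact div_le_div_of_nonneg_right (Finset.abs_sum_le_sum_abs _ _) (by positivity)

lemma ae_tendsto_sum_predictable_mul_innovation (hX : IsAERW P p q β X α m) (hp0 : 0 ≤ p)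
    (hp1 : p ≤ 1) (hq0 : 0 ≤ q) (hq1 : q ≤ 1) (hβ : 0 ≤ β)
    (hc : 2 * ((2 * p - 1) * (β + 1)) < 2 * β + 1) (x y : ℝ) :
    ∀ᵐ ω ∂P, Tendsto (fun j : ℕ => (∑ k ∈ Finset.Icc 1 (2 ^ j ^ 2),
      predictable β x y X k ω * innovation p β X k ω) / ((j : ℝ) + 1) ^ 2) atTop (𝓝 0) := by
  obtain ⟨K, hK0, hKi, hK⟩ := hX.exists_integral_sq_add_sq_le hp0 hp1 hq0 hq1 hβ hc
  set L := 8 * ((x + y) ^ 2 + (y + 1) ^ 2) with hL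
  have hL0 : 0 ≤ L := by positivity
  have hgb := hX.memLp_predictable hp0 hp1 hq0 hq1 hβ x y
  set M : ℕ → Ω → ℝ := fun n ω => ∑ k ∈ Finset.Icc 1 n,
    predictable β x y X k ω * innovation p β X k ω with hM
  have hMb : ∀ n, MemLp (M n) ⊤ P := fun n => memLp_finsetSum _ fun k _ =>
    (hX.memLp_innovation hp0 hp1 hq0 hq1 hβ k).mul (hgb k)
  have hMi : ∀ n, Integrable (fun ω => M n ω ^ 2) P := fun n => by
    simp only [pow_two]
    exact ((hMb n).mul (hMb n)).integrable le_top
  have hMv : ∀ n : ℕ, ∫ ω, M n ω ^ 2 ∂P ≤ L * K * (1 + Real.log n) := by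
    intro n
    refine (hX.integral_sum_mul_innovation_sq_le hp0 hp1 hq0 hq1 hβ
      (fun k n hk => measurable_past_predictable x y hk) hgb n).trans ?_
    refine (Finset.sum_le_sum (g := fun k : ℕ => L * K * (1 / (k : ℝ)))
      fun k hk => ?_).trans ?_
    · have hk1 := (Finset.mem_Icc.1 hk).1
      have hn : (0 : ℝ) < k := by exact_mod_cast hk1
      have hgi : Integrable (fun ω => predictable β x y X k ω ^ 2) P := by
        simp only [pow_two]
        exact ((hgb k).mul (hgb k)).integrable le_top
      refine (integral_mono hgi ((hKi _).const_mul _)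
        fun ω => predictable_sq_le hβ x y X hk1 ω).trans ?_
      rw [integral_const_mul]
      refine (mul_le_mul_of_nonneg_left (hK _ hk1) (by positivity)).trans_eq ?_
      rw [hL]
      field_simp
    · rw [← Finset.mul_sum]
      exact mul_le_mul_of_nonneg_left (sum_Icc_one_div_le n) (mul_nonneg hL0 hK0)
  -- The square is divided by `(j + 1)⁴`: since `1 + j² log 2 ≤ (j + 1)²`, the variance bound uses
  -- up one factor `(j + 1)²` and the other gives summability.
  have h := ae_tendsto_zero_of_integral_le (P := P) (C := L * K)
    (f := fun j ω => M (2 ^ j ^ 2) ω ^ 2 / (((j : ℝ) + 1) ^ 2) ^ 2)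
    (fun j ω => by positivity) (fun j => (hMi _).div_const _) fun j => by
      rw [integral_div, pow_two (((j : ℝ) + 1) ^ 2), ← div_div]
      refine div_le_div_of_nonneg_right ?_ (by positivity)
      rw [div_le_iff₀ (by positivity)]
      refine (hMv _).trans (mul_le_mul_of_nonneg_left ?_ (mul_nonneg hL0 hK0))
      rw [Nat.cast_pow, Real.log_pow]
      push_cast
      have h2 : Real.log 2 ≤ 1 := by linarith [Real.log_two_lt_d9]
      have h3 := mul_le_mul_of_nonneg_left h2 (sq_nonneg (j : ℝ))
      have h4 : (0 : ℝ) ≤ j := Nat.cast_nonneg j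
      linarith
  filter_upwards [h] with ω h
  refine (tendsto_zero_iff_abs_tendsto_zero _).2 ?_
  have h2 := h.sqrt
  rw [Real.sqrt_zero] at h2
  refine h2.congr fun j => ?_
  rw [← div_pow, Real.sqrt_sq_eq_abs]
  rfl

end IsAERW

end AmnesicElephant

/-! ### The quadratic strong law -/

theorem theorem2p2 {Ω : Type*} [MeasurableSpace Ω] (P : Measure Ω) [IsProbabilityMeasure P]
    (p q β : ℝ) (hp0 : 0 ≤ p) (hp1 : p ≤ 1) (hq0 : 0 ≤ q) (hq1 : q ≤ 1) (hβ : 0 ≤ β)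
    (hdiff : p < (4 * β + 3) / (4 * (β + 1)))
    (X : ℕ → Ω → ℝ) (α : ℕ → Ω → ℝ) (m : ℕ → Ω → ℕ)
    (hX : AmnesicElephant.IsAERW P p q β X α m) :
    ∀ᵐ ω ∂P, Tendsto
      (fun n : ℕ => 1 / Real.log (n : ℝ) *
        ∑ k ∈ Finset.Icc 1 n, (AmnesicElephant.position X k ω) ^ 2 / (k : ℝ) ^ 2)
      atTop (𝓝 (AmnesicElephant.sigmaSq p β)) := by
  rw [lt_div_iff₀ (by positivity)] at hdiff
  have hc : 2 * ((2 * p - 1) * (β + 1)) < 2 * β + 1 := by linarith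
  -- If `a ≥ 1`, then `2a(β + 1) ≥ 2β + 2`, against the diffusive condition.
  have ha : 0 < 1 - (2 * p - 1) := by
    by_contra! h
    nlinarith
  set a := 2 * p - 1 with ha_def
  -- `y` and then `x` solve the two cancellation equations of `quadratic_recursion` with `c = a(β +
  -- 1)`.
  obtain ⟨y, hy⟩ : ∃ y, y = a / (1 - a) := ⟨_, rfl⟩
  obtain ⟨x, hx⟩ : ∃ x, x = 2 * y * (a * (β + 1)) / (2 * β + 1 - 2 * (a * (β + 1))) := ⟨_, rfl⟩
  have hd : 0 < 2 * β + 1 - 2 * (a * (β + 1)) := by linarith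
  have hy' : y * (β + 1 - a * (β + 1)) = a * (β + 1) := by
    rw [hy]
    field_simp
  have hx' : x * (2 * β + 1 - 2 * (a * (β + 1))) = 2 * y * (a * (β + 1)) := by
    rw [hx, div_mul_cancel₀ _ hd.ne']
  have hσ : x + 2 * y + 1 = AmnesicElephant.sigmaSq p β := by
    have hd' : 1 + 2 * β - 2 * a * (β + 1) ≠ 0 := by
      have : 1 + 2 * β - 2 * a * (β + 1) = 2 * β + 1 - 2 * (a * (β + 1)) := by ring
      rw [this]
      exact hd.ne'
    simp only [AmnesicElephant.sigmaSq, ← ha_def]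
    have hy1 : y * (1 - a) = a := by rw [hy, div_mul_cancel₀ _ ha.ne']
    rw [eq_div_iff (mul_ne_zero ha.ne' hd')]
    linear_combination (1 - a) * hx' + (2 * (1 + 2 * β - 2 * a * (β + 1)) +
      2 * a * (β + 1)) * hy1
  filter_upwards [hX.step_sq_ae hp0 hp1 hq0 hq1 hβ,
    hX.ae_tendsto_quadratic hp0 hp1 hq0 hq1 hβ hc x y (fun j => 2 ^ j ^ 2 + 1) fun j => by simp,
    hX.ae_tendsto_quadratic hp0 hp1 hq0 hq1 hβ hc x y (fun _ => 1) fun _ => le_rfl,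
    hX.ae_tendsto_sum_remainder hp0 hp1 hq0 hq1 hβ hc x y fun j => 2 ^ j ^ 2,
    hX.ae_tendsto_sum_predictable_mul_innovation hp0 hp1 hq0 hq1 hβ hc x y] with ω h h1 h2 h3 h4
  have hT : Monotone fun n : ℕ => ∑ k ∈ Finset.Icc 1 n, AmnesicElephant.position X k ω ^ 2 / (k : ℝ) ^ 2 :=
    fun i j hij => Finset.sum_le_sum_of_subset_of_nonneg (Finset.Icc_subset_Icc_right hij)
      fun _ _ _ => by positivity
  have key := AmnesicElephant.tendsto_div_log_of_monotone hT (fun n => by positivity) (L := AmnesicElephant.sigmaSq p β) ?_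
  · exact key.congr fun n => by rw [div_eq_mul_inv, mul_comm, one_div]
  have hlim := (((AmnesicElephant.tendsto_sum_one_div_succ_along_two_pow_sq.const_mul (x + 2 * y + 1)).add
    (h2.sub h1)).add h4).add h3
  rw [sub_zero, add_zero, add_zero, add_zero, hσ] at hlim
  refine hlim.congr fun j => ?_
  rw [AmnesicElephant.sum_position_sq_div_eq hβ rfl hy' hx' h, hσ]
  ring
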